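/- Let $G$ be a finite group, let $p$ be a prime, and let $N$ be a non-abelian normal $p$-subgroup of $G$ that is minimal among the normal subgroups of $G$ not contained in $Z(G)$. Then the following hold. (i) One has $[N,N]\le Z(N)$, and if $\varphi\in\mathrm{Irr}(Z(N))$ is a complex irreducible character that is nontrivial on $[N,N]$ (that is, $\varphi(z)\neq 1$ for some $z\in[N,N]$), then $\varphi$ is fully ramified with respect to $N/Z(N)$; i.e. the induced character satisfies $\varphi^{N}=e\theta$ for some complex irreducible character $\theta\in\mathrm{Irr}(N)$ and some positive integer $e$ with $e^2=|N/Z(N)|$. (ii) If $p>2$, then $G/Z(N)$ splits over $N/Z(N)$, i.e. $N/Z(N)$ has a complement in $G/Z(N)$. Moreover, $N$ is not contained in the Frattini subgroup $\Phi(G)$, the intersection of all maximal subgroups of $G$. -/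

import Mathlib

/-- `χ` is a complex irreducible character of `H`, i.e. `χ ∈ Irr(H)`: the trace of an irreducible
finite-dimensional complex representation (realized, without loss of generality, on `ℂⁿ`). -/
def IsIrrChar {H : Type*} [Group H] (χ : H → ℂ) : Prop :=
  ∃ (n : ℕ) (ρ : Representation ℂ H (Fin n → ℂ)), ρ.IsIrreducible ∧ ρ.character = χ

open Classical in
/-- The induced class function `φ^H` of a class function `φ` of a subgroup `K` of the finite
group `H`: `φ^H(g) = |K|⁻¹ ∑_{x ∈ H} φ°(x⁻¹ g x)`, where `φ°` is `φ` extended by zero. -/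
noncomputable def inducedClassFun {H : Type*} [Group H] [Finite H] (K : Subgroup H)
    (φ : K → ℂ) : H → ℂ := fun g =>
  (Nat.card K : ℂ)⁻¹ *
    ∑ᶠ x : H, if h : x⁻¹ * g * x ∈ K then φ ⟨x⁻¹ * g * x, h⟩ else 0

/-- A character `φ` of a subgroup `K` of `H` is fully ramified with respect to `H/K`:
`φ^H = e θ` with `θ ∈ Irr(H)` and `e² = |H : K|`. -/
def IsFullyRamified {H : Type*} [Group H] [Finite H] (K : Subgroup H) (φ : K → ℂ) : Prop :=
  ∃ (e : ℕ) (θ : H → ℂ), IsIrrChar θ ∧ e ^ 2 = K.index ∧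
    ∀ g : H, inducedClassFun K φ g = (e : ℂ) * θ g

/-- The group `H` splits over its subgroup `M`: there is a subgroup `C` with `M C = H` and
`M ∩ C = 1`. -/
def SplitsOver {H : Type*} [Group H] (M : Subgroup H) : Prop :=
  ∃ C : Subgroup H, Subgroup.IsComplement' M C

/-!
If `φ` is a linear character of `Z(N)` that is nontrivial on `[N, N]`, then minimality of `N` makes
the pairing `(x, y) ↦ φ [x, y]` on `N / Z(N)` nondegenerate, since its radical is normal in `G`.
Hence for each `g ∉ Z(N)` some conjugate of `g` is `z g` with `z` central and `φ z ≠ 1`, so an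
irreducible character of `N` over `φ` vanishes off `Z(N)`, and first orthogonality gives
`θ(1)² = |N : Z(N)|`.

If `|N|` is odd, Baer's multiplication `x y [x, y]^{-1/2}` makes `N` abelian, so `φ` extends to a
linear character `f` of that group. Conjugation by `n ∈ N` multiplies `f` by `x ↦ φ [n, x]`, and by
nondegeneracy these are all the linear characters of `N / Z(N)`. Thus `N / Z(N)` permutes the
extensions of `φ` simply transitively, and the Frattini argument shows that the stabilizer of `f`
in `G` supplements `N` and meets it in `Z(N)`.
-/

open Subgroup
open scoped commutatorElement IsMulCommutative

section CommutatorPairing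

variable {H : Type*} [Group H] (hc : commutator H ≤ center H)

/-- The commutator map of a group of nilpotency class at most two, as a bilinear pairing with
values in the center. -/
def commutatorPairing : H →* H →* center H :=
  MonoidHom.mk' (fun x => MonoidHom.mk'
    (fun y => ⟨⁅x, y⁆, hc (commutator_mem_commutator (mem_top x) (mem_top y))⟩)
    fun y w => Subtype.ext <| by
      have hxw := hc (commutator_mem_commutator (mem_top x) (mem_top w))
      simp only [commutatorElement_mul_right_eq_mul_conj, coe_mul]
      rw [mul_assoc _ y, mem_center_iff.1 hxw y, ← mul_assoc, mul_inv_cancel_right])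
    fun x y => MonoidHom.ext fun w => Subtype.ext <| by
      have hyw := hc (commutator_mem_commutator (mem_top y) (mem_top w))
      simp only [MonoidHom.mk'_apply, MonoidHom.mul_apply, coe_mul,
        commutatorElement_mul_left_eq_conj_mul]
      rw [mem_center_iff.1 hyw x, mul_inv_cancel_right, ← mem_center_iff.1 hyw]

@[simp]
theorem coe_commutatorPairing (x y : H) : (commutatorPairing hc x y : H) = ⁅x, y⁆ := rfl

theorem commutatorPairing_swap (x y : H) :
    commutatorPairing hc y x = (commutatorPairing hc x y)⁻¹ :=
  Subtype.ext (commutatorElement_inv x y).symm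

theorem commutatorPairing_self (x : H) : commutatorPairing hc x x = 1 :=
  Subtype.ext (commutatorElement_self x)

theorem commutatorPairing_eq_one_of_mem_center_left {z : H} (hz : z ∈ center H) (x : H) :
    commutatorPairing hc z x = 1 :=
  Subtype.ext (commutatorElement_eq_one_iff_mul_comm.2 (mem_center_iff.1 hz x).symm)

theorem commutatorPairing_eq_one_of_mem_center_right (x : H) {z : H} (hz : z ∈ center H) :
    commutatorPairing hc x z = 1 :=
  Subtype.ext (commutatorElement_eq_one_iff_mul_comm.2 (mem_center_iff.1 hz x))

theorem commutatorPairing_map_mulAut (α : MulAut H) (hα : ∀ z ∈ center H, α z = z) (x y : H) :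
    commutatorPairing hc (α x) (α y) = commutatorPairing hc x y :=
  Subtype.ext ((map_commutatorElement α x y).symm.trans (hα _ (commutatorPairing hc x y).2))

variable {A : Type*} [CommGroup A] (φ : center H →* A)

/-- The pairing `(x, y) ↦ φ [x, y]` induced by a linear character `φ` of the center. -/
def characterPairing : H →* H →* A :=
  (MonoidHom.compHom φ).comp (commutatorPairing hc)

@[simp]
theorem characterPairing_apply (x y : H) :
    characterPairing hc φ x y = φ (commutatorPairing hc x y) := rfl

theorem mem_ker_characterPairing {x : H} :
    x ∈ (characterPairing hc φ).ker ↔ ∀ y, φ (commutatorPairing hc x y) = 1 := by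
  rw [MonoidHom.mem_ker, MonoidHom.ext_iff]
  rfl

theorem center_le_ker_characterPairing : center H ≤ (characterPairing hc φ).ker := fun z hz =>
  (mem_ker_characterPairing hc φ).2 fun y => by
    rw [commutatorPairing_eq_one_of_mem_center_left hc hz, map_one]

variable {hc φ} in
theorem map_eq_one_of_characterPairing_eq_one (h : characterPairing hc φ = 1) {z : center H}
    (hz : (z : H) ∈ commutator H) : φ z = 1 := by
  have hle : commutator H ≤ φ.ker.map (center H).subtype := by
    rw [commutator_eq_closure, closure_le]
    rintro _ ⟨x, y, rfl⟩
    exact ⟨commutatorPairing hc x y, DFunLike.congr_fun (DFunLike.congr_fun h x) y, rfl⟩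
  exact (mem_map_iff_mem (center H).subtype_injective).1 (hle hz)

/-- A linear character `φ` of the center is nondegenerate if the pairing `(x, y) ↦ φ [x, y]` on
`H / Z(H)` is. -/
def IsNondegenerate : Prop := (characterPairing hc φ).ker ≤ center H

end CommutatorPairing

section Duality

variable {H : Type*} [Group H] [Finite H] {hc : commutator H ≤ center H}
  {k : Type*} [CommRing k] [HasEnoughRootsOfUnity k (Monoid.exponent H)]

theorem card_ker_domRestrictHom_of_commutator_le {K : Subgroup H} [K.Normal]
    (hK : commutator H ≤ K) : Nat.card (MonoidHom.domRestrictHom K kˣ).ker = K.index := by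
  have := Subgroup.Normal.quotient_commutative_iff_commutator_le.2 hK
  have := HasEnoughRootsOfUnity.of_dvd k (Group.exponent_quotient_dvd K)
  rw [Nat.card_congr (MonoidHom.domRestrictHomKerEquiv kˣ K).toEquiv,
    CommGroup.card_monoidHom_of_hasEnoughRootsOfUnity, index]

theorem IsNondegenerate.range_characterPairing {φ : center H →* kˣ} (hφ : IsNondegenerate hc φ) :
    (characterPairing hc φ).range = (MonoidHom.domRestrictHom (center H) kˣ).ker := by
  have hcard := card_ker_domRestrictHom_of_commutator_le (k := k) hc
  have := Nat.finite_of_card_ne_zero (hcard.trans_ne index_ne_zero_of_finite)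
  refine eq_of_le_of_card_ge ?_ ?_
  · rintro _ ⟨x, rfl⟩
    exact MonoidHom.domRestrict_eq_one_iff.2 fun z hz => by
      rw [characterPairing_apply, commutatorPairing_eq_one_of_mem_center_right hc x hz, map_one]
  · rw [hcard, ← index_ker, hφ.antisymm (center_le_ker_characterPairing hc φ)]

theorem IsNondegenerate.exists_characterPairing_eq {φ : center H →* kˣ}
    (hφ : IsNondegenerate hc φ) {χ : H →* kˣ} (hχ : ∀ z ∈ center H, χ z = 1) :
    ∃ n, characterPairing hc φ n = χ :=
  MonoidHom.mem_range.1 <| hφ.range_characterPairing ▸ MonoidHom.domRestrict_eq_one_iff.2 hχ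

end Duality

section Baer

variable {H : Type*} [Group H] (hc : commutator H ≤ center H) (r : center H →* center H)

/-- The multiplication `x ∘ y = x y [x, y]^{-1/2}` of Baer's trick, for a square root `r` on the
center. -/
def baerMul (x y : H) : H := x * y * ((characterPairing hc r x y)⁻¹ : center H)

theorem baerMul_of_mem_center (x : H) {z : H} (hz : z ∈ center H) : baerMul hc r x z = x * z := by
  simp [baerMul, commutatorPairing_eq_one_of_mem_center_right hc x hz]

theorem baerMul_one (x : H) : baerMul hc r x 1 = x := by
  rw [baerMul_of_mem_center hc r x (one_mem _), mul_one]

theorem baerMul_inv (x : H) : baerMul hc r x x⁻¹ = 1 := by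
  simp [baerMul, commutatorPairing_self]

theorem baerMul_assoc (x y w : H) :
    baerMul hc r (baerMul hc r x y) w = baerMul hc r x (baerMul hc r y w) := by
  have hl (c : center H) (v : H) : commutatorPairing hc c v = 1 :=
    commutatorPairing_eq_one_of_mem_center_left hc c.2 v
  have hr (v : H) (c : center H) : commutatorPairing hc v c = 1 :=
    commutatorPairing_eq_one_of_mem_center_right hc v c.2
  simp only [baerMul, characterPairing_apply, map_mul, MonoidHom.mul_apply, hl, hr, map_one,
    mul_one, mul_inv]
  rw [mul_assoc (x * y), ← mem_center_iff.1 (Subtype.prop _) w]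
  simp only [mul_assoc, ← coe_mul]
  congr 4
  rw [← mul_assoc, mul_comm]

variable {r}

theorem baerMul_comm (hr : ∀ z, r z ^ 2 = z) (x y : H) : baerMul hc r x y = baerMul hc r y x := by
  have hxy : x * y = y * x * commutatorPairing hc x y := by
    rw [mem_center_iff.1 (Subtype.prop _), coe_commutatorPairing, commutatorElement_def]
    group
  simp only [baerMul, characterPairing_apply, commutatorPairing_swap hc x y, map_inv, inv_inv]
  rw [hxy, mul_assoc, ← coe_mul]
  congr 2
  rw [mul_inv_eq_iff_eq_mul, ← sq, hr]

/-- A copy of `H` carrying the abelian multiplication `baerMul`. -/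
def BaerGroup (_hc : commutator H ≤ center H) (_hr : ∀ z, r z ^ 2 = z) : Type _ := H

instance (hr : ∀ z, r z ^ 2 = z) [Finite H] : Finite (BaerGroup hc hr) := ‹Finite H›

instance (hr : ∀ z, r z ^ 2 = z) : CommGroup (BaerGroup hc hr) where
  mul := baerMul hc r (H := H)
  one := (1 : H)
  inv := Inv.inv (α := H)
  mul_assoc := baerMul_assoc hc r
  one_mul x := (baerMul_comm hc hr _ _).trans (baerMul_one hc r x)
  mul_one := baerMul_one hc r
  inv_mul_cancel x := (baerMul_comm hc hr _ _).trans (baerMul_inv hc r x)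
  mul_comm := baerMul_comm hc hr

/-- The inclusion of the center, on which the multiplication is unchanged. -/
def BaerGroup.ofCenter (hr : ∀ z, r z ^ 2 = z) : center H →* BaerGroup hc hr where
  toFun z := (z : H)
  map_one' := rfl
  map_mul' x z := (baerMul_of_mem_center hc r (x : H) z.2).symm

theorem BaerGroup.ofCenter_injective (hr : ∀ z, r z ^ 2 = z) :
    Function.Injective (BaerGroup.ofCenter hc hr) := Subtype.val_injective

/-- A function `f` on `H` which extends `φ` and is a linear character for the multiplication
`baerMul`. -/
structure IsBaerCharacter (r : center H →* center H) {A : Type*} [CommGroup A] (φ : center H →* A)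
    (f : H → A) : Prop where
  coe_center (z : center H) : f z = φ z
  map_baerMul (x y : H) : f (baerMul hc r x y) = f x * f y

variable {hc}

theorem exists_isBaerCharacter [Finite H] (hr : ∀ z, r z ^ 2 = z) {k : Type*} [CommRing k]
    [HasEnoughRootsOfUnity k (Monoid.exponent (BaerGroup hc hr))] (φ : center H →* kˣ) :
    ∃ f, IsBaerCharacter hc r φ f := by
  let e := MonoidHom.ofInjective (BaerGroup.ofCenter_injective hc hr)
  obtain ⟨f, hf⟩ := MonoidHom.domRestrict_surjective k (BaerGroup.ofCenter hc hr).range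
    (φ.comp e.symm.toMonoidHom)
  refine ⟨f, fun z => ?_, f.map_mul⟩
  simpa [e] using! DFunLike.congr_fun hf (e z)

namespace IsBaerCharacter

variable {A : Type*} [CommGroup A] {φ : center H →* A} {f f' : H → A}

theorem apply_of_mem_center (hf : IsBaerCharacter hc r φ f) {z : H} (hz : z ∈ center H) :
    f z = φ ⟨z, hz⟩ :=
  hf.coe_center ⟨z, hz⟩

theorem apply_mul (hf : IsBaerCharacter hc r φ f) (x y : H) :
    f (x * y) = f x * f y * φ (r (commutatorPairing hc x y)) := by
  set c := characterPairing hc r x y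
  have hxy : x * y = baerMul hc r (baerMul hc r x y) c := by
    rw [baerMul_of_mem_center hc r _ c.2, baerMul, coe_inv, inv_mul_cancel_right]
  rw [hxy, hf.map_baerMul, hf.map_baerMul, hf.coe_center]
  rfl

theorem conj (hf : IsBaerCharacter hc r φ f) (n x : H) :
    f (n * x * n⁻¹) = characterPairing hc φ n x * f x := by
  have hnx : n * x * n⁻¹ = commutatorPairing hc n x * x := (inv_mul_cancel_right _ x).symm
  rw [hnx, hf.apply_mul,
    commutatorPairing_eq_one_of_mem_center_left hc (Subtype.prop _), map_one, map_one, mul_one,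
    hf.coe_center, characterPairing_apply]

theorem comp_mulAut (hf : IsBaerCharacter hc r φ f) {α : MulAut H} (hα : ∀ z ∈ center H, α z = z) :
    IsBaerCharacter hc r φ (f ∘ α) where
  coe_center z := by rw [Function.comp_apply, hα z z.2, hf.coe_center]
  map_baerMul x y := by
    have : α (baerMul hc r x y) = baerMul hc r (α x) (α y) := by
      simp only [baerMul, characterPairing_apply, commutatorPairing_map_mulAut hc α hα,
        map_mul, hα _ (Subtype.prop _)]
    rw [Function.comp_apply, this, hf.map_baerMul]
    rfl

/-- The ratio of two Baer characters over the same `φ` is a genuine linear character of `H`: the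
factors by which they fail to be multiplicative on `H` cancel. -/
def div (hf' : IsBaerCharacter hc r φ f') (hf : IsBaerCharacter hc r φ f) : H →* A :=
  MonoidHom.mk' (f' / f) fun x y => by
    simp only [Pi.div_apply, hf'.apply_mul, hf.apply_mul, mul_div_mul_right_eq_div,
      mul_div_mul_comm]

theorem div_apply (hf' : IsBaerCharacter hc r φ f') (hf : IsBaerCharacter hc r φ f) (x : H) :
    hf'.div hf x = f' x / f x := rfl

theorem exists_conj_eq [Finite H] {k : Type*} [CommRing k]
    [HasEnoughRootsOfUnity k (Monoid.exponent H)] {φ : center H →* kˣ} {f f' : H → kˣ}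
    (hf' : IsBaerCharacter hc r φ f') (hf : IsBaerCharacter hc r φ f) (hφ : IsNondegenerate hc φ) :
    ∃ n, ∀ x, f' x = f (n * x * n⁻¹) := by
  obtain ⟨n, hn⟩ := hφ.exists_characterPairing_eq (χ := hf'.div hf) fun z hz => by
    rw [div_apply, hf'.apply_of_mem_center hz, hf.apply_of_mem_center hz, div_self']
  exact ⟨n, fun x => by rw [hf.conj, hn, div_apply, div_mul_cancel]⟩

end IsBaerCharacter

end Baer

section Representations

variable {k G V : Type*} [Field k] [Group G] [AddCommGroup V] [Module k V]

/-- The subrepresentations of a subrepresentation `σ` are the subrepresentations below `σ`. -/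
def subrepresentationEquivIic {ρ : Representation k G V} (σ : Subrepresentation ρ) :
    Subrepresentation σ.toRepresentation ≃o Set.Iic σ where
  toFun τ := ⟨⟨τ.toSubmodule.map σ.toSubmodule.subtype, by
    rintro g _ ⟨w, hw, rfl⟩
    exact ⟨σ.toRepresentation g w, τ.apply_mem_toSubmodule g hw, rfl⟩⟩,
    Submodule.map_subtype_le _ _⟩
  invFun τ := ⟨τ.1.toSubmodule.comap σ.toSubmodule.subtype,
    fun g _ hv => τ.1.apply_mem_toSubmodule g hv⟩
  left_inv τ := Subrepresentation.toSubmodule_injective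
    (Submodule.comap_map_eq_of_injective σ.toSubmodule.injective_subtype _)
  right_inv τ := Subtype.ext <| Subrepresentation.toSubmodule_injective <|
    (Submodule.map_comap_subtype _ _).trans (inf_eq_right.2 τ.2)
  map_rel_iff' := Submodule.map_le_map_iff_of_injective σ.toSubmodule.injective_subtype _ _

theorem exists_subrepresentation_le_isIrreducible [FiniteDimensional k V]
    {ρ : Representation k G V} {W : Subrepresentation ρ} (hW : W ≠ ⊥) :
    ∃ σ ≤ W, σ.toRepresentation.IsIrreducible := by
  have : WellFoundedLT (Subrepresentation ρ) :=
    ⟨InvImage.wf Subrepresentation.toSubmodule wellFounded_lt⟩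
  have := isAtomic_of_orderBot_wellFounded_lt (wellFounded_lt (α := Subrepresentation ρ))
  obtain ⟨σ, hσ, hσW⟩ := (eq_bot_or_exists_atom_le W).resolve_left hW
  exact ⟨σ, hσW,
    (subrepresentationEquivIic σ).isSimpleOrder_iff.2 (Set.isSimpleOrder_Iic_iff_isAtom.2 hσ)⟩

theorem isIrreducible_of_equiv {W : Type*} [AddCommGroup W] [Module k W]
    {ρ : Representation k G V} {σ : Representation k G W} (e : ρ.Equiv σ) [ρ.IsIrreducible] :
    σ.IsIrreducible :=
  have : IsSimpleModule _ σ.asModule := .congr (N := ρ.asModule) <| .symm <| .ofBijective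
    (Representation.IntertwiningMap.equivLinearMapAsModule ρ σ e.toIntertwiningMap)
    e.toLinearEquiv.bijective
  σ.irreducible_iff_isSimpleModule_asModule.2 this

theorem isIrrChar_character [Module ℂ V] [FiniteDimensional ℂ V] (ρ : Representation ℂ G V)
    [ρ.IsIrreducible] : IsIrrChar ρ.character := by
  let b := (Module.finBasis ℂ V).equivFun
  let σ : Representation ℂ G (Fin (Module.finrank ℂ V) → ℂ) :=
    (b.conjRingEquiv : Module.End ℂ V →* _).comp ρ
  have e : ρ.Equiv σ := .mk b fun g => LinearMap.ext fun v => by simp [σ]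
  exact ⟨_, σ, isIrreducible_of_equiv e, (Representation.char_iso e).symm⟩

theorem character_mul_of_eq_smul {ρ : Representation k G V} {z : G} {c : k}
    (hz : ρ z = c • 1) (g : G) : ρ.character (z * g) = c * ρ.character g := by
  rw [Representation.character, map_mul, hz, smul_one_mul, map_smul, smul_eq_mul,
    Representation.character]

theorem character_of_eq_smul [FiniteDimensional k V] {ρ : Representation k G V} {z : G} {c : k}
    (hz : ρ z = c • 1) : ρ.character z = c * Module.finrank k V := by
  simpa using character_mul_of_eq_smul hz 1

theorem exists_monoidHom_eq_character_of_finrank_eq_one (ρ : Representation k G V)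
    (hV : Module.finrank k V = 1) : ∃ ψ : G →* kˣ, ∀ g, ρ.character g = ψ g := by
  have : FiniteDimensional k V := .of_finrank_eq_succ hV
  have hρ (g : G) : ρ g = ρ.character g • 1 := by
    obtain ⟨c, hc, -⟩ := (ρ g).existsUnique_eq_smul_id_of_finrank_eq_one hV
    rw [Representation.character, hc]
    simp [hV]
    rfl
  let ψ : G →* k :=
    { toFun := ρ.character
      map_one' := by rw [ρ.char_one, hV, Nat.cast_one]
      map_mul' := fun x y => character_mul_of_eq_smul (hρ x) y }
  exact ⟨ψ.toHomUnits, fun _ => rfl⟩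

theorem IsIrrChar.exists_monoidHom [IsMulCommutative G] {χ : G → ℂ} (hχ : IsIrrChar χ) :
    ∃ ψ : G →* ℂˣ, ∀ g, χ g = ψ g := by
  obtain ⟨n, ρ, hρ, rfl⟩ := hχ
  exact exists_monoidHom_eq_character_of_finrank_eq_one ρ
    (Representation.IsIrreducible.finrank_eq_one_of_isMulCommutative ρ)

end Representations

section FullyRamified

variable {k H V : Type*} [Field k] [Group H] [AddCommGroup V] [Module k V] {K : Subgroup H}

/-- The right regular representation of `H` on the functions `H → k`. -/
def rightRegular (k H : Type*) [Field k] [Group H] : Representation k H (H → k) where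
  toFun g := LinearMap.funLeft k k (· * g)
  map_one' := by ext; simp
  map_mul' g h := LinearMap.ext fun f => funext fun x => by
    simp [LinearMap.funLeft_apply, mul_assoc]

/-- The functions on `H` on which the central subgroup `K` acts through `φ`. -/
def centralFunctions (hK : K ≤ center H) (φ : K →* kˣ) :
    Subrepresentation (rightRegular k H) where
  toSubmodule :=
    { carrier := {f | ∀ (z : K) (x : H), f (x * z) = φ z * f x}
      add_mem' := fun ha hb z x => by simp only [Pi.add_apply, ha z x, hb z x, mul_add]
      zero_mem' := fun z x => by simp
      smul_mem' := fun c f hf z x => by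
        simp only [Pi.smul_apply, smul_eq_mul, hf z x, mul_left_comm] }
  apply_mem_toSubmodule g f hf z x := by
    change f (x * z * g) = φ z * f (x * g)
    rw [← hf z (x * g), mul_assoc, mul_assoc, mem_center_iff.1 (hK z.2) g]

theorem centralFunctions_ne_bot (hK : K ≤ center H) (φ : K →* kˣ) :
    centralFunctions hK φ ≠ ⊥ := by
  classical
  intro h
  let f : H → k := fun x => if hx : x ∈ K then φ ⟨x, hx⟩ else 0
  have hf : f ∈ (centralFunctions hK φ).toSubmodule := fun z x => by
    by_cases hx : x ∈ K
    · have hxz : φ ⟨x * z, K.mul_mem hx z.2⟩ = φ z * φ ⟨x, hx⟩ := by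
        rw [mul_comm, ← map_mul]; rfl
      simp only [f, K.mul_mem_cancel_right z.2, hx, dif_pos, hxz, Units.val_mul]
    · simp only [f, K.mul_mem_cancel_right z.2, hx, dif_neg, not_false_eq_true, mul_zero]
  rw [h] at hf
  simpa [f, one_mem] using! congrFun ((Submodule.mem_bot k).1 hf) 1

theorem exists_isIrreducible_over [Finite H] (hK : K ≤ center H) (φ : K →* kˣ) :
    ∃ σ : Subrepresentation (rightRegular k H), σ.toRepresentation.IsIrreducible ∧
      ∀ z : K, σ.toRepresentation z = (φ z : k) • 1 := by
  obtain ⟨σ, hσ, hirr⟩ :=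
    exists_subrepresentation_le_isIrreducible (centralFunctions_ne_bot hK φ)
  exact ⟨σ, hirr, fun z => LinearMap.ext fun v => Subtype.ext (funext (hσ v.2 z))⟩

theorem character_eq_zero_of_conj {ρ : Representation k H V} {g y z : H} {c : k}
    (hyz : y * g * y⁻¹ = z * g) (hz : ρ z = c • 1) (hc : c ≠ 1) : ρ.character g = 0 := by
  have h : ρ.character g = c * ρ.character g := by
    rw [← character_mul_of_eq_smul hz, ← hyz, ρ.char_conj]
  exact (mul_left_eq_self₀.1 h.symm).resolve_left hc

theorem finrank_sq_eq_index_of_character_eq_zero [IsAlgClosed k] [CharZero k] [Finite H]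
    [FiniteDimensional k V] (ρ : Representation k H V) [ρ.IsIrreducible] {φ : K →* kˣ}
    (hφ : ∀ z : K, ρ z = (φ z : k) • 1) (hzero : ∀ g ∉ K, ρ.character g = 0) :
    Module.finrank k V ^ 2 = K.index := by
  classical
  have := Fintype.ofFinite H
  have hcard : (Nat.card H : k) ≠ 0 := Nat.cast_ne_zero.2 Nat.card_pos.ne'
  have := invertibleOfNonzero hcard
  have hterm (g : H) : ρ.character g * ρ.character g⁻¹ =
      if g ∈ K then (Module.finrank k V : k) ^ 2 else 0 := by
    split_ifs with hg
    · rw [character_of_eq_smul (hφ ⟨g, hg⟩),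
        character_of_eq_smul (z := g⁻¹) (hφ ⟨g, hg⟩⁻¹), map_inv,
        mul_mul_mul_comm, Units.mul_inv, one_mul, sq]
    · rw [hzero g hg, zero_mul]
  have hsum : ∑ g : H, ρ.character g * ρ.character g⁻¹ =
      Nat.card K * (Module.finrank k V : k) ^ 2 := by
    simp_rw [hterm]
    rw [← Finset.sum_filter, Finset.sum_const, nsmul_eq_mul, Nat.card_eq_fintype_card,
      Fintype.card_subtype]
  have horth := Representation.char_orthonormal ρ ρ
  rw [if_pos ⟨.refl ρ⟩, hsum, inv_mul_eq_one₀ hcard, ← K.card_mul_index] at horth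
  exact (Nat.eq_of_mul_eq_mul_left Nat.card_pos (by exact_mod_cast horth)).symm

theorem inducedClassFun_coe [Finite H] (hK : K ≤ center H) (φ : K → ℂ) (z : K) :
    inducedClassFun K φ z = K.index * φ z := by
  classical
  have hconj (x : H) : x⁻¹ * z * x = z := by
    rw [mul_assoc, ← mem_center_iff.1 (hK z.2) x, inv_mul_cancel_left]
  have := Fintype.ofFinite H
  have hcard : (Nat.card K : ℂ) ≠ 0 := Nat.cast_ne_zero.2 Nat.card_pos.ne'
  simp only [inducedClassFun, hconj, Subtype.prop, dif_pos, Subtype.coe_eta,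
    finsum_eq_sum_of_fintype, Finset.sum_const, Finset.card_univ, Fintype.card_eq_nat_card,
    nsmul_eq_mul]
  rw [← K.card_mul_index, Nat.cast_mul, mul_assoc, inv_mul_cancel_left₀ hcard]

theorem inducedClassFun_of_notMem [Finite H] [K.Normal] (φ : K → ℂ) {g : H} (hg : g ∉ K) :
    inducedClassFun K φ g = 0 := by
  have hconj (x : H) : x⁻¹ * g * x ∉ K := fun h => hg <| by
    simpa [mul_assoc] using ‹K.Normal›.conj_mem _ h x
  simp [inducedClassFun, hconj]

theorem isFullyRamified_of_character_eq_zero [Finite H] (hK : K ≤ center H) [Module ℂ V]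
    [FiniteDimensional ℂ V] (ρ : Representation ℂ H V) [ρ.IsIrreducible] {φ : K →* ℂˣ}
    (hφ : ∀ z : K, ρ z = (φ z : ℂ) • 1) (hzero : ∀ g ∉ K, ρ.character g = 0) :
    IsFullyRamified K (fun z => (φ z : ℂ)) := by
  have hindex := finrank_sq_eq_index_of_character_eq_zero ρ hφ hzero
  refine ⟨_, ρ.character, isIrrChar_character ρ, hindex, fun g => ?_⟩
  by_cases hg : g ∈ K
  · lift g to K using hg
    rw [inducedClassFun_coe hK, character_of_eq_smul (hφ g), ← hindex]
    push_cast
    ring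
  · have : K.Normal := ⟨fun z hz x => by rwa [mem_center_iff.1 (hK hz), mul_inv_cancel_right]⟩
    rw [inducedClassFun_of_notMem _ hg, hzero g hg, mul_zero]

theorem IsNondegenerate.isFullyRamified [Finite H] {hc : commutator H ≤ center H}
    {φ : center H →* ℂˣ} (hφ : IsNondegenerate hc φ) :
    IsFullyRamified (center H) (fun z => (φ z : ℂ)) := by
  obtain ⟨σ, hirr, hσ⟩ := exists_isIrreducible_over (le_refl (center H)) φ
  refine isFullyRamified_of_character_eq_zero le_rfl σ.toRepresentation hσ fun g hg => ?_
  obtain ⟨y, hy⟩ : ∃ y, φ (commutatorPairing hc g y) ≠ 1 := by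
    by_contra! h
    exact hg (hφ ((mem_ker_characterPairing hc φ).2 h))
  refine character_eq_zero_of_conj (y := y) (inv_mul_cancel_right _ g).symm
    (hσ (commutatorPairing hc y g)) ?_
  simpa [commutatorPairing_swap hc g y] using hy

end FullyRamified

section Supplements

variable {G : Type*} [Group G] {N S : Subgroup G} [N.Normal]

theorem splitsOver_map_mk' {Z : Subgroup G} [Z.Normal] (hinf : S ⊓ N = Z) (hsup : N ⊔ S = ⊤) :
    SplitsOver (N.map (QuotientGroup.mk' Z)) := by
  refine ⟨S.map (QuotientGroup.mk' Z), isComplement'_of_disjoint_and_mul_eq_univ ?_ ?_⟩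
  · rw [disjoint_def]
    rintro _ ⟨n, hn, rfl⟩ ⟨s, hs, hsn⟩
    have hsn : s⁻¹ * n ∈ S := (hinf.ge (QuotientGroup.eq.1 hsn)).1
    exact (QuotientGroup.eq_one_iff n).2
      (hinf.le ⟨(S.mul_mem_cancel_left (S.inv_mem hs)).1 hsn, hn⟩)
  · have := Normal.map ‹N.Normal› _ (QuotientGroup.mk'_surjective Z)
    rw [← normal_mul, ← Subgroup.map_sup, hsup,
      map_top_of_surjective _ (QuotientGroup.mk'_surjective Z), coe_top]

theorem exists_isCoatom_ge_of_finiteIndex [S.FiniteIndex] (hS : S ≠ ⊤) :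
    ∃ M, IsCoatom M ∧ S ≤ M := by
  obtain ⟨M, ⟨hSM, hM⟩, hmin⟩ :=
    (InvImage.wf index wellFounded_lt).has_min {M | S ≤ M ∧ M ≠ ⊤} ⟨S, le_rfl, hS⟩
  have := finiteIndex_of_le hSM
  exact ⟨M, ⟨hM, fun L hL => by_contra fun hne =>
    hmin L ⟨hSM.trans hL.le, hne⟩ (index_strictAnti hL)⟩, hSM⟩

theorem not_le_frattini_of_sup_eq_top [Finite N] (hsup : N ⊔ S = ⊤) (hS : S ≠ ⊤) :
    ¬ N ≤ frattini G := fun hN => by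
  have hfin : S.FiniteIndex := by
    have hsurj : Function.Surjective fun n : N => (n : G ⧸ S) := fun q => by
      obtain ⟨g, rfl⟩ := QuotientGroup.mk_surjective q
      obtain ⟨n, hn, s, hs, rfl⟩ := mem_sup_of_normal_left.1 (hsup ▸ mem_top g)
      exact ⟨⟨n, hn⟩, (QuotientGroup.mk_mul_of_mem n hs).symm⟩
    have := Finite.of_surjective _ hsurj
    exact finiteIndex_of_finite_quotient
  obtain ⟨M, hM, hSM⟩ := exists_isCoatom_ge_of_finiteIndex hS
  exact hM.1 (top_unique (hsup ▸ sup_le (hN.trans (frattini_le_coatom hM)) hSM))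

end Supplements

section Inertia

variable {G : Type*} [Group G] {N : Subgroup G} [N.Normal]

/-- The stabilizer in `G` of a function `f` on the normal subgroup `N`, under conjugation. -/
def inertiaSubgroup {A : Type*} (f : N → A) : Subgroup G where
  carrier := {g | ∀ x, f (MulAut.conjNormal g x) = f x}
  mul_mem' {a b} ha hb x := by rw [map_mul, MulAut.mul_apply, ha, hb]
  one_mem' x := by rw [map_one, MulAut.one_apply]
  inv_mem' {a} ha x := by
    rw [← ha, ← MulAut.mul_apply, ← map_mul, mul_inv_cancel, map_one, MulAut.one_apply]

variable {hc : commutator N ≤ center N} {r : center N →* center N}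

theorem conjNormal_apply_of_mem_center (hz : (center N).map N.subtype ≤ center G) (g : G) {z : N}
    (hzN : z ∈ center N) : MulAut.conjNormal g z = z :=
  Subtype.ext <| by
    have hgz : g * z = z * g := mem_center_iff.1 (hz ⟨z, hzN, rfl⟩) g
    rw [MulAut.conjNormal_apply, hgz, mul_inv_cancel_right]

theorem IsBaerCharacter.inertiaSubgroup_inf {A : Type*} [CommGroup A] {φ : center N →* A}
    {f : N → A} (hf : IsBaerCharacter hc r φ f) (hφ : IsNondegenerate hc φ) :
    inertiaSubgroup f ⊓ N = (center N).map N.subtype := by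
  have hker : center N = (characterPairing hc φ).ker :=
    (center_le_ker_characterPairing hc φ).antisymm hφ
  have hmem (n : N) : (n : G) ∈ inertiaSubgroup f ↔ n ∈ center N := by
    simp_rw [hker, mem_ker_characterPairing]
    refine forall_congr' fun x => ?_
    rw [MulAut.conjNormal_val, MulAut.conj_apply, hf.conj, mul_eq_right, characterPairing_apply]
  ext g
  constructor
  · rintro ⟨hgS, hgN⟩
    exact ⟨⟨g, hgN⟩, (hmem ⟨g, hgN⟩).1 hgS, rfl⟩
  · rintro ⟨n, hn, rfl⟩
    exact ⟨(hmem n).2 hn, n.2⟩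

theorem IsBaerCharacter.sup_inertiaSubgroup [Finite N] {k : Type*} [CommRing k]
    [HasEnoughRootsOfUnity k (Monoid.exponent N)] {φ : center N →* kˣ} {f : N → kˣ}
    (hf : IsBaerCharacter hc r φ f) (hφ : IsNondegenerate hc φ)
    (hz : (center N).map N.subtype ≤ center G) : N ⊔ inertiaSubgroup f = ⊤ := by
  refine eq_top_iff.2 fun g _ => ?_
  obtain ⟨n, hn⟩ := (hf.comp_mulAut fun _ =>
    conjNormal_apply_of_mem_center hz g⁻¹).exists_conj_eq hf hφ
  have hng : n * g ∈ inertiaSubgroup f := fun x => by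
    rw [map_mul, MulAut.mul_apply, MulAut.conjNormal_val, MulAut.conj_apply, ← hn,
      Function.comp_apply, ← MulAut.mul_apply, ← map_mul, inv_mul_cancel, map_one,
      MulAut.one_apply]
  exact mem_sup_of_normal_left.2
    ⟨_, N.inv_mem n.2, _, hng, inv_mul_cancel_left (n : G) g⟩

end Inertia

section MinimalNoncentral

variable {G : Type*} [Group G] {N : Subgroup G}

theorem map_subtype_le_center_or_eq_top
    (hmin : Minimal (fun M : Subgroup G => M.Normal ∧ ¬ M ≤ center G) N)
    (K : Subgroup N) [hK : (K.map N.subtype).Normal] : K.map N.subtype ≤ center G ∨ K = ⊤ := by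
  by_contra! h
  refine h.2 (map_subtype_inj.1 ?_)
  rw [← MonoidHom.range_eq_map, range_subtype]
  exact (map_subtype_le K).antisymm (hmin.2 ⟨hK, h.1⟩ (map_subtype_le K))

theorem le_center_of_map_subtype_le_center {K : Subgroup N} (hK : K.map N.subtype ≤ center G) :
    K ≤ center N := fun x hx =>
  mem_center_iff.2 fun y => Subtype.ext (mem_center_iff.1 (hK ⟨x, hx, rfl⟩) y)

variable [N.Normal]

theorem map_center_le_center_of_minimal (hna : ¬ ∀ x y : N, x * y = y * x)
    (hmin : Minimal (fun M : Subgroup G => M.Normal ∧ ¬ M ≤ center G) N) :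
    (center N).map N.subtype ≤ center G :=
  (map_subtype_le_center_or_eq_top hmin (center N)).resolve_right fun h =>
    hna fun x y => mem_center_iff.1 (h ▸ mem_top y) x

theorem commutator_le_center_of_minimal [Group.IsSolvable N] (hna : ¬ ∀ x y : N, x * y = y * x)
    (hmin : Minimal (fun M : Subgroup G => M.Normal ∧ ¬ M ≤ center G) N) :
    commutator N ≤ center N := by
  have : Nontrivial N := by
    by_contra! h
    exact hna fun x y => Subsingleton.elim _ _
  exact le_center_of_map_subtype_le_center <|
    (map_subtype_le_center_or_eq_top hmin (commutator N)).resolve_right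
      (Group.IsSolvable.commutator_lt_top_of_nontrivial N).ne

theorem normal_map_ker_characterPairing (hz : (center N).map N.subtype ≤ center G)
    (hc : commutator N ≤ center N) {A : Type*} [CommGroup A] (φ : center N →* A) :
    ((characterPairing hc φ).ker.map N.subtype).Normal := ⟨by
  rintro _ ⟨x, hx, rfl⟩ g
  refine ⟨MulAut.conjNormal g x, (mem_ker_characterPairing hc φ).2 fun y => ?_,
    MulAut.conjNormal_apply g x⟩
  obtain ⟨y, rfl⟩ := (MulAut.conjNormal g).surjective y
  rw [commutatorPairing_map_mulAut hc _ fun _ => conjNormal_apply_of_mem_center hz g]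
  exact (mem_ker_characterPairing hc φ).1 hx y⟩

theorem isNondegenerate_of_minimal
    (hmin : Minimal (fun M : Subgroup G => M.Normal ∧ ¬ M ≤ center G) N)
    (hz : (center N).map N.subtype ≤ center G) (hc : commutator N ≤ center N)
    {A : Type*} [CommGroup A] {φ : center N →* A}
    (hφ : ∃ z : center N, (z : N) ∈ commutator N ∧ φ z ≠ 1) : IsNondegenerate hc φ := by
  have := normal_map_ker_characterPairing hz hc φ
  refine le_center_of_map_subtype_le_center <|
    (map_subtype_le_center_or_eq_top hmin (characterPairing hc φ).ker).resolve_right fun h => ?_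
  obtain ⟨z, hzc, hne⟩ := hφ
  exact hne (map_eq_one_of_characterPairing_eq_one (MonoidHom.ker_eq_top_iff.1 h) hzc)

end MinimalNoncentral

theorem exists_center_character_ne_one {H : Type*} [Group H] [Finite H]
    (hna : ¬ ∀ x y : H, x * y = y * x) (hc : commutator H ≤ center H) (k : Type*) [CommRing k]
    [HasEnoughRootsOfUnity k (Monoid.exponent (center H))] :
    ∃ (φ : center H →* kˣ) (z : center H), (z : H) ∈ commutator H ∧ φ z ≠ 1 := by
  push Not at hna
  obtain ⟨x, y, hxy⟩ := hna
  obtain ⟨φ, hφ⟩ := CommGroup.exists_apply_ne_one_of_hasEnoughRootsOfUnity (center H) k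
    (a := commutatorPairing hc x y) fun h =>
      hxy (commutatorElement_eq_one_iff_mul_comm.1 (congrArg Subtype.val h))
  exact ⟨φ, commutatorPairing hc x y, commutator_mem_commutator (mem_top x) (mem_top y), hφ⟩

theorem exists_monoidHom_sq_eq_of_odd_card {A : Type*} [CommGroup A] (hA : Odd (Nat.card A)) :
    ∃ r : A →* A, ∀ z, r z ^ 2 = z := by
  obtain ⟨m, hm⟩ := hA
  refine ⟨powMonoidHom (m + 1), fun z => ?_⟩
  rw [powMonoidHom_apply, ← pow_mul, show (m + 1) * 2 = Nat.card A + 1 by omega, pow_succ,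
    pow_card_eq_one', one_mul]

theorem odd_card_of_isPGroup {p : ℕ} (hp : p.Prime) (hp2 : p ≠ 2) {H : Type*} [Group H] [Finite H]
    (hH : IsPGroup p H) : Odd (Nat.card H) := by
  have := Fact.mk hp
  obtain ⟨n, hn⟩ := IsPGroup.iff_card.1 hH
  exact hn ▸ (hp.odd_of_ne_two hp2).pow

theorem exists_supplement_inf_eq_center {G : Type*} [Group G] {N : Subgroup G} [N.Normal]
    [Finite N] (hc : commutator N ≤ center N) (hz : (center N).map N.subtype ≤ center G)
    (hodd : Odd (Nat.card N)) {φ : center N →* ℂˣ} (hφ : IsNondegenerate hc φ) :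
    ∃ S : Subgroup G, S ⊓ N = (center N).map N.subtype ∧ N ⊔ S = ⊤ := by
  obtain ⟨r, hr⟩ := exists_monoidHom_sq_eq_of_odd_card
    (hodd.of_dvd_nat (card_subgroup_dvd_card (center N)))
  obtain ⟨f, hf⟩ := exists_isBaerCharacter (hc := hc) hr φ
  exact ⟨inertiaSubgroup f, hf.inertiaSubgroup_inf hφ, hf.sup_inertiaSubgroup hφ hz⟩

theorem proposition2p1_general {G : Type*} [Group G] (N : Subgroup G) [N.Normal] [Finite N]
    [Group.IsSolvable N] (hna : ¬ ∀ x y : N, x * y = y * x)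
    (hmin : Minimal (fun M : Subgroup G => M.Normal ∧ ¬ M ≤ center G) N) :
    (commutator N ≤ center N ∧
      ∀ φ : center N → ℂ, IsIrrChar φ →
        (∃ z : center N, (z : N) ∈ commutator N ∧ φ z ≠ 1) → IsFullyRamified (center N) φ) ∧
    (Odd (Nat.card N) →
      SplitsOver (N.map (QuotientGroup.mk' ((center N).map N.subtype))) ∧ ¬ N ≤ frattini G) := by
  have hc := commutator_le_center_of_minimal hna hmin
  have hz := map_center_le_center_of_minimal hna hmin
  refine ⟨⟨hc, fun χ hχ hne => ?_⟩, fun hodd => ?_⟩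
  · obtain ⟨φ, hφ⟩ := hχ.exists_monoidHom
    obtain rfl : χ = fun z => (φ z : ℂ) := funext hφ
    simp only [ne_eq, Units.val_eq_one] at hne
    exact (isNondegenerate_of_minimal hmin hz hc hne).isFullyRamified
  · obtain ⟨φ, hne⟩ := exists_center_character_ne_one hna hc ℂ
    obtain ⟨S, hinf, hsup⟩ := exists_supplement_inf_eq_center hc hz hodd
      (isNondegenerate_of_minimal hmin hz hc hne)
    refine ⟨splitsOver_map_mk' hinf hsup, not_le_frattini_of_sup_eq_top hsup ?_⟩
    rintro rfl
    exact hmin.1.2 ((top_inf_eq N).symm.trans hinf ▸ hz)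

theorem proposition2p1 {G : Type*} [Group G] [Finite G] (p : ℕ) (hp : p.Prime)
    (N : Subgroup G) [N.Normal] (hpN : IsPGroup p N)
    (hna : ¬ ∀ x y : N, x * y = y * x)
    (hmin : Minimal (fun M : Subgroup G => M.Normal ∧ ¬ M ≤ Subgroup.center G) N) :
    (commutator N ≤ Subgroup.center N ∧
      ∀ φ : Subgroup.center N → ℂ, IsIrrChar φ →
        (∃ z : Subgroup.center N, (z : N) ∈ commutator N ∧ φ z ≠ 1) →
        IsFullyRamified (Subgroup.center N) φ) ∧
    (2 < p →
      SplitsOver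
        (N.map (QuotientGroup.mk' ((Subgroup.center N).map N.subtype))) ∧
      ¬ N ≤ frattini G) := by
  have := Fact.mk hp
  have := hpN.isNilpotent
  exact (proposition2p1_general N hna hmin).imp_right fun h hp2 =>
    h (odd_card_of_isPGroup hp hp2.ne' hpN)
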